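/- Let $n\ge 1$, let $\Omega\subset\mathbb R^n$ be a bounded domain with $C^2$ boundary, and let $M\in C^2([0,+\infty);\mathbb R)$. Consider the heat equation with memory $$\partial_t y-\Delta y+\int_0^t M(t-s)\,y(s,x)\,ds=0\ \text{ in }(0,\infty)\times\Omega,\qquad y=0\ \text{ on }(0,\infty)\times\partial\Omega,\qquad y(0,\cdot)=y_0,\qquad(\ast)$$ with $y_0\in L^2(\Omega)$ (real-valued). Let $A=\Delta$ be the Dirichlet Laplacian on $L^2(\Omega)$, with domain $D(A)=\{f\in H^1_0(\Omega):\Delta f\in L^2(\Omega)\}$ (which equals $H^2(\Omega)\cap H^1_0(\Omega)$, as $\partial\Omega$ is $C^2$). The solution $y(\cdot;y_0)\in C([0,\infty);L^2(\Omega))$ of $(\ast)$ is the mild one: $y(0)=y_0$ and, for all $t\ge0$, $\int_0^t y(s)\,ds\in D(A)$ and $$y(t)=y_0+A\int_0^t y(s)\,ds-\int_0^t\!\int_0^s M(s-r)\,y(r)\,dr\,ds.$$ Let $(\lambda_k)_{k\ge1}$ be an enumeration of the eigenvalues of $-A$ (repetitions allowed, for instance according to multiplicity). For each $k\ge 1$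 let $x_k\in C([0,\infty);\mathbb R)$ be the solution of $$x_k'(t)+\lambda_k x_k(t)+\int_0^t M(t-s)\,x_k(s)\,ds=0\quad(t>0),\qquad x_k(0)=1,$$ and let $\mathcal N_k=\{t>0: x_k(t)=0\}$. Let $m\ge1$ and $t_1,\dots,t_m\in(0,+\infty)$. Then the following are equivalent: (i) Equation $(\ast)$ has backward uniqueness at $\{t_j\}_{j=1}^m$, that is, for every $y_0\in L^2(\Omega)$, if $y(t_j;y_0)=0$ in $L^2(\Omega)$ for each $j=1,\dots,m$, then $y_0=0$. (ii) For each $k\ge1$ there is $j_k\in\{1,\dots,m\}$ such that $t_{j_k}\notin\mathcal N_k$. -/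

import Mathlib

open MeasureTheory Set
open scoped ContDiff ENNReal

noncomputable section

namespace HeatMemory

/-- Euclidean space `ℝⁿ`. -/
abbrev RSpace (n : ℕ) : Type := EuclideanSpace ℝ (Fin n)

/-- The real Hilbert space `L²(Ω)` (Lebesgue measure on `Ω`). -/
abbrev L2 {n : ℕ} (Ω : Set (RSpace n)) : Type := Lp ℝ 2 (volume.restrict Ω)

/-- `Ω` has a `C²` boundary: near every boundary point, `Ω` is the set where a `C²` function
with nowhere vanishing derivative is negative. -/
def HasC2Boundary {n : ℕ} (Ω : Set (RSpace n)) : Prop :=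
  ∀ p ∈ frontier Ω, ∃ (U : Set (RSpace n)) (ρ : RSpace n → ℝ),
    IsOpen U ∧ p ∈ U ∧ ContDiffOn ℝ 2 ρ U ∧ (∀ x ∈ U, fderiv ℝ ρ x ≠ 0) ∧
      Ω ∩ U = {x | x ∈ U ∧ ρ x < 0}

/-- `Ω ⊆ ℝⁿ` is a bounded domain (nonempty, open, connected) with a `C²` boundary. -/
structure IsBoundedC2Domain {n : ℕ} (Ω : Set (RSpace n)) : Prop where
  isOpen : IsOpen Ω
  isConnected : IsConnected Ω
  isBounded : Bornology.IsBounded Ω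
  boundary : HasC2Boundary Ω

/-- The test functions on `Ω`: the elements of `C_c^∞(Ω)`. -/
def IsTestFunction {n : ℕ} (Ω : Set (RSpace n)) (φ : RSpace n → ℝ) : Prop :=
  ContDiff ℝ ∞ φ ∧ HasCompactSupport φ ∧ tsupport φ ⊆ Ω

/-- The classical partial derivative `∂φ/∂xᵢ`. -/
def partialDeriv {n : ℕ} (i : Fin n) (φ : RSpace n → ℝ) (x : RSpace n) : ℝ :=
  fderiv ℝ φ x (EuclideanSpace.single i 1)

/-- `v ∈ L²(Ω)` is the weak partial derivative `∂u/∂xᵢ` of `u ∈ L²(Ω)`. -/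
def HasWeakPartialDeriv {n : ℕ} (Ω : Set (RSpace n)) (i : Fin n) (u v : L2 Ω) : Prop :=
  ∀ φ : RSpace n → ℝ, IsTestFunction Ω φ →
    ∫ x in Ω, u x * partialDeriv i φ x = -∫ x in Ω, v x * φ x

/-- `u ∈ H₀¹(Ω)`: the function `u ∈ L²(Ω)` has weak first derivatives `g i` in `L²(Ω)`, and it
lies in the closure of `C_c^∞(Ω)` for the `H¹` norm. -/
def MemH10 {n : ℕ} (Ω : Set (RSpace n)) (u : L2 Ω) : Prop :=
  ∃ g : Fin n → L2 Ω, (∀ i, HasWeakPartialDeriv Ω i u (g i)) ∧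
    ∀ ε : ℝ≥0∞, 0 < ε → ∃ φ : RSpace n → ℝ, IsTestFunction Ω φ ∧
      eLpNorm (fun x => u x - φ x) 2 (volume.restrict Ω) < ε ∧
      ∀ i, eLpNorm (fun x => g i x - partialDeriv i φ x) 2 (volume.restrict Ω) < ε

/-- `f ∈ L²(Ω)` is the weak (distributional) Laplacian `Δu` of `u ∈ L²(Ω)`. -/
def HasWeakLaplacian {n : ℕ} (Ω : Set (RSpace n)) (u f : L2 Ω) : Prop :=
  ∀ φ : RSpace n → ℝ, IsTestFunction Ω φ →
    ∫ x in Ω, u x * Laplacian.laplacian φ x = ∫ x in Ω, f x * φ x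

/-- `u ∈ D(A)` and `A u = f`, for the Dirichlet Laplacian `A = Δ` on `L²(Ω)`, with domain
`D(A) = {u ∈ H₀¹(Ω) : Δu ∈ L²(Ω)}`. (On a bounded `C²` domain, `D(A) = H²(Ω) ∩ H₀¹(Ω)`.) -/
def IsDirichletLaplacian {n : ℕ} (Ω : Set (RSpace n)) (u f : L2 Ω) : Prop :=
  MemH10 Ω u ∧ HasWeakLaplacian Ω u f

/-- `μ` is an eigenvalue of `-A`. -/
def IsDirichletEigenvalue {n : ℕ} (Ω : Set (RSpace n)) (μ : ℝ) : Prop :=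
  ∃ e : L2 Ω, e ≠ 0 ∧ IsDirichletLaplacian Ω e (-(μ • e))

/-- `y` is the (mild) solution, continuous on `[0,∞)` with values in `L²(Ω)`, of
`∂ₜy - Δy + ∫₀ᵗ M(t-s) y(s) ds = 0` in `Ω`, `y = 0` on `∂Ω`, `y(0) = y₀`:
for all `t ≥ 0`, `∫₀ᵗ y(s) ds ∈ D(A)` and
`y(t) = y₀ + A ∫₀ᵗ y(s) ds - ∫₀ᵗ ∫₀ˢ M(s-r) y(r) dr ds`. -/
structure IsSolution {n : ℕ} (Ω : Set (RSpace n)) (M : ℝ → ℝ) (y₀ : L2 Ω) (y : ℝ → L2 Ω) :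
    Prop where
  continuousOn : ContinuousOn y (Ici 0)
  initial : y 0 = y₀
  equation : ∀ t : ℝ, 0 ≤ t →
    IsDirichletLaplacian Ω (∫ s in (0 : ℝ)..t, y s)
      (y t - y₀ + ∫ s in (0 : ℝ)..t, ∫ r in (0 : ℝ)..s, M (s - r) • y r)

/-- Backward uniqueness at the times `t j`: an initial datum `y₀ ∈ L²(Ω)` whose solution vanishes
at all of the times `t j` is zero. -/
def HasBackwardUniquenessAt {n : ℕ} (Ω : Set (RSpace n)) (M : ℝ → ℝ) {m : ℕ} (t : Fin m → ℝ) :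
    Prop :=
  ∀ (y₀ : L2 Ω) (y : ℝ → L2 Ω), IsSolution Ω M y₀ y → (∀ j, y (t j) = 0) → y₀ = 0

/-- `x` is the solution on `[0,∞)` of
`x'(t) + μ x(t) + ∫₀ᵗ M(t-s) x(s) ds = 0` for `t > 0`, `x(0) = 1`. -/
structure IsModeSolution (M : ℝ → ℝ) (μ : ℝ) (x : ℝ → ℝ) : Prop where
  continuousOn : ContinuousOn x (Ici 0)
  initial : x 0 = 1
  equation : ∀ t : ℝ, 0 < t →
    HasDerivAt x (-(μ * x t) - ∫ s in (0 : ℝ)..t, M (t - s) * x s) t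

/-- The zeros of `x` in `(0,∞)`. -/
def nodalSet (x : ℝ → ℝ) : Set ℝ := {t | 0 < t ∧ x t = 0}

end HeatMemory

end

/-!
Let `A` be the Dirichlet Laplacian on `L²(Ω)`. Along an eigenfunction `e` of `-A` with eigenvalue
`λ`, symmetry of `A` turns the equation with memory into a scalar Volterra equation for
`z t = ⟪e, y t⟫`, whose unique solution is `z t = ⟪e, y₀⟫ x t`, with `x` the mode of `λ`
(`IsSolution.inner_eigenvector_eq`). If some `t j` is not a zero of `x`, then `y (t j) = 0` forces
`⟪e, y₀⟫ = 0`; as the eigenfunctions span a dense subspace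
(`eq_zero_of_forall_inner_eigenvector`), `y₀ = 0` as soon as this happens for every eigenvalue.
Conversely, if the mode of `λ` vanishes at all the `t j`, then `x t • e` is a nonzero solution which
vanishes there (`IsModeSolution.isSolution_smul`).

Density of the eigenfunctions follows from the spectral theorem for the compact self-adjoint
operator `(1 - A)⁻¹ = ι ι*`, where `ι` is the inclusion of `H₀¹(Ω)` into `L²(Ω)`. The space `H₀¹(Ω)`
is the closure of the pairs `(φ, ∇φ)` in a finite power of `L²(Ω)`, and `A u = f` is equivalent to
`(1 - A)⁻¹ (u - f) = u` (`isDirichletLaplacian_iff`), so that all facts about `A` are read off from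
the bounded operator. Compactness of `ι` (`isCompactOperator_incl`) holds for any bounded `Ω`: the
averages of `φ` over a grid of cubes of side `δ` approximate `φ` in `L²` with error `O(δ ‖∇φ‖)`, and
only finitely many cubes meet `Ω`, so `ι` is a norm limit of finite rank operators. The error bound
comes from the estimate `‖φ(· + h) - φ‖ ≤ ‖h‖ ‖∇φ‖` averaged over small `h`.
-/

namespace HeatMemory

open scoped InnerProductSpace

/-! ### Test functions -/

section TestFunctions

variable {n : ℕ} {Ω : Set (RSpace n)} {φ ψ : RSpace n → ℝ}

theorem contDiff_partialDeriv (hφ : ContDiff ℝ ∞ φ) (i : Fin n) :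
    ContDiff ℝ ∞ (partialDeriv i φ) :=
  (hφ.fderiv_right (m := ∞) (by simp)).clm_apply contDiff_const

theorem IsTestFunction.partialDeriv (hφ : IsTestFunction Ω φ) (i : Fin n) :
    IsTestFunction Ω (partialDeriv i φ) := by
  have hsub : tsupport (HeatMemory.partialDeriv i φ) ⊆ tsupport φ := by
    refine closure_minimal (fun x hx => ?_) (isClosed_tsupport φ)
    by_contra h
    exact hx (by simp [HeatMemory.partialDeriv, fderiv_of_notMem_tsupport (𝕜 := ℝ) h])
  exact ⟨contDiff_partialDeriv hφ.1 i,
    hφ.2.1.of_isClosed_subset (isClosed_tsupport _) hsub, hsub.trans hφ.2.2⟩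

theorem partialDeriv_add (hφ : ContDiff ℝ ∞ φ) (hψ : ContDiff ℝ ∞ ψ) (i : Fin n) :
    partialDeriv i (φ + ψ) = partialDeriv i φ + partialDeriv i ψ := by
  ext x
  simp [partialDeriv, fderiv_add (hφ.differentiable (by simp) x) (hψ.differentiable (by simp) x)]

theorem partialDeriv_smul (c : ℝ) (hφ : ContDiff ℝ ∞ φ) (i : Fin n) :
    partialDeriv i (c • φ) = c • partialDeriv i φ := by
  ext x
  simp [partialDeriv, fderiv_const_smul (hφ.differentiable (by simp) x)]

theorem IsTestFunction.add (hφ : IsTestFunction Ω φ) (hψ : IsTestFunction Ω ψ) :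
    IsTestFunction Ω (φ + ψ) :=
  ⟨hφ.1.add hψ.1, hφ.2.1.add hψ.2.1,
    (tsupport_add φ ψ).trans (union_subset hφ.2.2 hψ.2.2)⟩

theorem IsTestFunction.smul (c : ℝ) (hφ : IsTestFunction Ω φ) : IsTestFunction Ω (c • φ) :=
  ⟨hφ.1.const_smul c, hφ.2.1.smul_left (f := fun _ => c),
    (tsupport_smul_subset_right (fun _ => c) φ).trans hφ.2.2⟩

theorem isTestFunction_zero : IsTestFunction Ω (0 : RSpace n → ℝ) :=
  ⟨contDiff_const, HasCompactSupport.zero, by simp [tsupport]⟩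

theorem IsTestFunction.memLp (hφ : IsTestFunction Ω φ) :
    MemLp φ 2 (volume.restrict Ω) :=
  (hφ.1.continuous.memLp_of_hasCompactSupport hφ.2.1).restrict Ω

theorem IsTestFunction.eq_zero_of_notMem (hφ : IsTestFunction Ω φ) {x : RSpace n} (hx : x ∉ Ω) :
    φ x = 0 :=
  image_eq_zero_of_notMem_tsupport fun h => hx (hφ.2.2 h)

/-- Integration by parts: there is no boundary term, because test functions vanish near `∂Ω`. -/
theorem IsTestFunction.setIntegral_mul_partialDeriv (hφ : IsTestFunction Ω φ)
    (hψ : IsTestFunction Ω ψ) (i : Fin n) :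
    ∫ x in Ω, φ x * HeatMemory.partialDeriv i ψ x =
      -∫ x in Ω, HeatMemory.partialDeriv i φ x * ψ x := by
  have hint : ∀ {f g : RSpace n → ℝ}, IsTestFunction Ω f → IsTestFunction Ω g →
      Integrable (fun x => f x * g x) := fun hf hg =>
    (hf.1.continuous.mul hg.1.continuous).integrable_of_hasCompactSupport hf.2.1.mul_right
  rw [setIntegral_eq_integral_of_forall_compl_eq_zero fun x hx => by
      rw [hφ.eq_zero_of_notMem hx, zero_mul],
    setIntegral_eq_integral_of_forall_compl_eq_zero fun x hx => by
      rw [hψ.eq_zero_of_notMem hx, mul_zero]]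
  exact integral_mul_fderiv_eq_neg_fderiv_mul_of_integrable (hint (hφ.partialDeriv i) hψ)
    (hint hφ (hψ.partialDeriv i)) (hint hφ hψ) (fun x _ => hφ.1.differentiable (by simp) x)
    (fun x _ => hψ.1.differentiable (by simp) x)

theorem laplacian_eq_sum_partialDeriv (hφ : ContDiff ℝ ∞ φ) (x : RSpace n) :
    Laplacian.laplacian φ x = ∑ i, partialDeriv i (partialDeriv i φ) x := by
  rw [InnerProductSpace.laplacian_eq_iteratedFDeriv_orthonormalBasis φ
    (EuclideanSpace.basisFun (Fin n) ℝ)]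
  refine Finset.sum_congr rfl fun i _ => ?_
  have hd : DifferentiableAt ℝ (fderiv ℝ φ) x :=
    (hφ.fderiv_right (m := ∞) (by simp)).differentiable (by simp) x
  rw [iteratedFDeriv_two_apply]
  change _ = fderiv ℝ (fun y => fderiv ℝ φ y (EuclideanSpace.single i 1)) x
    (EuclideanSpace.single i 1)
  rw [fderiv_clm_apply hd (differentiableAt_const _)]
  simp

theorem real_inner_eq_setIntegral_mul (u : L2 Ω) {v : L2 Ω} (hv : v =ᵐ[volume.restrict Ω] φ) :
    ⟪u, v⟫_ℝ = ∫ x in Ω, u x * φ x := by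
  rw [L2.inner_def]
  refine integral_congr_ae ?_
  filter_upwards [hv] with x hx
  simp [hx, mul_comm]

end TestFunctions

/-! ### The space `H₀¹(Ω)` and the resolvent of the Dirichlet Laplacian -/

section Resolvent

variable {n : ℕ} (Ω : Set (RSpace n))

/-- The ambient Hilbert space of pairs `(u, (gᵢ)ᵢ)` of elements of `L²(Ω)`, the function being
stored at `none` and its gradient at `some i`. Its norm restricts to the `H¹` norm on the pairs
`(u, ∇u)`. -/
abbrev H1Ambient : Type := PiLp 2 (fun _ : Option (Fin n) => L2 Ω)

/-- The pairs `(φ, ∇φ)` for `φ` a test function. -/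
noncomputable def testGraph : Submodule ℝ (H1Ambient Ω) where
  carrier := {w | ∃ φ, IsTestFunction Ω φ ∧ w none =ᵐ[volume.restrict Ω] φ ∧
    ∀ i, w (some i) =ᵐ[volume.restrict Ω] partialDeriv i φ}
  add_mem' := by
    rintro v w ⟨φ, hφ, h0, h1⟩ ⟨ψ, hψ, k0, k1⟩
    refine ⟨φ + ψ, hφ.add hψ, ?_, fun i => ?_⟩
    · exact (Lp.coeFn_add _ _).trans (h0.add k0)
    · rw [partialDeriv_add hφ.1 hψ.1]
      exact (Lp.coeFn_add _ _).trans ((h1 i).add (k1 i))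
  zero_mem' := by
    refine ⟨0, isTestFunction_zero, Lp.coeFn_zero _ _ _, fun i => ?_⟩
    have : partialDeriv i (0 : RSpace n → ℝ) = 0 := by ext x; simp [partialDeriv]
    rw [this]
    exact Lp.coeFn_zero _ _ _
  smul_mem' := by
    rintro c w ⟨φ, hφ, h0, h1⟩
    refine ⟨c • φ, hφ.smul c, ?_, fun i => ?_⟩
    · exact (Lp.coeFn_smul _ _).trans (h0.const_smul c)
    · rw [partialDeriv_smul c hφ.1]
      exact (Lp.coeFn_smul _ _).trans ((h1 i).const_smul c)

/-- The Hilbert space `H₀¹(Ω)`, realized as the closure of the pairs `(φ, ∇φ)`. -/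
noncomputable abbrev H10 : Submodule ℝ (H1Ambient Ω) := (testGraph Ω).topologicalClosure

instance : CompleteSpace (H10 Ω) :=
  (testGraph Ω).isClosed_topologicalClosure.completeSpace_coe

/-- The inclusion `H₀¹(Ω) → L²(Ω)`. -/
noncomputable def H10.incl : H10 Ω →L[ℝ] L2 Ω :=
  (PiLp.proj 2 (fun _ : Option (Fin n) => L2 Ω) none).comp (H10 Ω).subtypeL

/-- The operator `(1 - Δ)⁻¹` on `L²(Ω)` with Dirichlet boundary conditions, written as `ι ι*` for
the inclusion `ι : H₀¹(Ω) → L²(Ω)`; that `ι* f` solves `u - Δu = f` is the Riesz representation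
theorem in `H₀¹(Ω)`. -/
noncomputable def dirichletResolvent : L2 Ω →L[ℝ] L2 Ω :=
  (H10.incl Ω).comp (ContinuousLinearMap.adjoint (H10.incl Ω))

variable {Ω}

@[simp] theorem H10.incl_apply (w : H10 Ω) : H10.incl Ω w = w.1 none := rfl

theorem exists_mem_testGraph {φ : RSpace n → ℝ} (hφ : IsTestFunction Ω φ) :
    ∃ w ∈ testGraph Ω, w none =ᵐ[volume.restrict Ω] φ ∧
      ∀ i, w (some i) =ᵐ[volume.restrict Ω] partialDeriv i φ := by
  let w : H1Ambient Ω := WithLp.toLp 2 fun o =>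
    o.elim (hφ.memLp.toLp φ) fun i => ((hφ.partialDeriv i).memLp).toLp (partialDeriv i φ)
  have h0 : w none =ᵐ[volume.restrict Ω] φ := hφ.memLp.coeFn_toLp
  have h1 : ∀ i, w (some i) =ᵐ[volume.restrict Ω] partialDeriv i φ := fun i =>
    ((hφ.partialDeriv i).memLp).coeFn_toLp
  exact ⟨w, ⟨φ, hφ, h0, h1⟩, h0, h1⟩

theorem H1Ambient.inner_eq (v w : H1Ambient Ω) :
    ⟪v, w⟫_ℝ = ⟪v none, w none⟫_ℝ + ∑ i, ⟪v (some i), w (some i)⟫_ℝ := by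
  rw [PiLp.inner_apply, Fintype.sum_option]

/-- The gradient component of an element of `H₀¹(Ω)` is its weak gradient. -/
theorem hasWeakPartialDeriv_of_mem_H10 {w : H1Ambient Ω} (hw : w ∈ H10 Ω) (i : Fin n) :
    HasWeakPartialDeriv Ω i (w none) (w (some i)) := by
  intro ψ hψ
  obtain ⟨p, -, hp0, hp1⟩ := exists_mem_testGraph hψ
  rw [← real_inner_eq_setIntegral_mul _ (hp1 i), ← real_inner_eq_setIntegral_mul _ hp0]
  have hcl : IsClosed {w : H1Ambient Ω |
      ⟪w none, p (some i)⟫_ℝ = -⟪w (some i), p none⟫_ℝ} :=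
    isClosed_eq (by fun_prop) (by fun_prop)
  refine closure_minimal ?_ hcl hw
  rintro v ⟨φ, hφ, h0, h1⟩
  have e1 : ⟪v none, p (some i)⟫_ℝ = ∫ x in Ω, φ x * partialDeriv i ψ x := by
    rw [real_inner_eq_setIntegral_mul _ (hp1 i)]
    exact integral_congr_ae (by filter_upwards [h0] with x hx; rw [hx])
  have e2 : ⟪v (some i), p none⟫_ℝ = ∫ x in Ω, partialDeriv i φ x * ψ x := by
    rw [real_inner_eq_setIntegral_mul _ hp0]
    exact integral_congr_ae (by filter_upwards [h1 i] with x hx; rw [hx])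
  rw [mem_ofPred_eq, e1, e2, hφ.setIntegral_mul_partialDeriv hψ]

theorem enorm_sub_eq_eLpNorm {u v : L2 Ω} {φ : RSpace n → ℝ}
    (hv : v =ᵐ[volume.restrict Ω] φ) :
    ‖u - v‖ₑ = eLpNorm (fun x => u x - φ x) 2 (volume.restrict Ω) := by
  rw [Lp.enorm_def]
  refine eLpNorm_congr_ae ?_
  filter_upwards [Lp.coeFn_sub u v, hv] with x hx hx'
  rw [hx, Pi.sub_apply, hx']

/-- `MemH10` describes the first components of the elements of `H10`: the weak gradient demanded in
`MemH10` comes for free from the closure. -/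
theorem memH10_iff {u : L2 Ω} : MemH10 Ω u ↔ ∃ w ∈ H10 Ω, w none = u := by
  constructor
  · rintro ⟨g, -, happ⟩
    let w : H1Ambient Ω := WithLp.toLp 2 fun o => o.elim u g
    refine ⟨w, ?_, rfl⟩
    have hcont : Continuous fun o : Option (Fin n) → L2 Ω => (WithLp.toLp 2 o : H1Ambient Ω) :=
      PiLp.continuous_toLp 2 _
    have hmem : (fun o => w o) ∈ closure ((fun (v : H1Ambient Ω) (o : Option (Fin n)) => v o) ''
        (testGraph Ω : Set (H1Ambient Ω))) := by
      rw [EMetric.mem_closure_iff]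
      intro ε hε
      obtain ⟨δ, hδ, hδε⟩ := exists_between hε
      obtain ⟨φ, hφ, h0, h1⟩ := happ δ hδ
      obtain ⟨p, hp, hp0, hp1⟩ := exists_mem_testGraph hφ
      refine ⟨_, ⟨p, hp, rfl⟩, lt_of_le_of_lt ?_ hδε⟩
      refine edist_pi_le_iff.2 fun o => ?_
      rw [edist_eq_enorm_sub]
      cases o with
      | none => exact (enorm_sub_eq_eLpNorm hp0).trans_le h0.le
      | some i => exact (enorm_sub_eq_eLpNorm (hp1 i)).trans_le (h1 i).le
    have := image_closure_subset_closure_image hcont (mem_image_of_mem _ hmem)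
    have himg : (fun v : H1Ambient Ω => (WithLp.toLp 2 fun o => v o : H1Ambient Ω)) ''
        (testGraph Ω : Set (H1Ambient Ω)) = testGraph Ω := image_id' _
    rw [image_image, himg] at this
    exact this
  · rintro ⟨w, hw, rfl⟩
    refine ⟨fun i => w (some i), hasWeakPartialDeriv_of_mem_H10 hw, fun ε hε => ?_⟩
    obtain ⟨p, ⟨φ, hφ, h0, h1⟩, hp⟩ := EMetric.mem_closure_iff.1 hw ε hε
    have hle : ∀ o, ‖w o - p o‖ₑ < ε := fun o => by
      rw [edist_eq_enorm_sub] at hp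
      refine lt_of_le_of_lt ?_ hp
      have := PiLp.norm_apply_le (w - p) o
      rw [PiLp.sub_apply] at this
      exact enorm_le_iff_norm_le.2 this
    exact ⟨φ, hφ, (enorm_sub_eq_eLpNorm h0).symm.trans_lt (hle none),
      fun i => (enorm_sub_eq_eLpNorm (h1 i)).symm.trans_lt (hle (some i))⟩

/-- The weak form of the Laplacian on `H₀¹(Ω)`: testing `Δu` amounts to testing `-∇u` against
gradients. -/
theorem setIntegral_mul_laplacian {w : H1Ambient Ω} (hw : w ∈ H10 Ω) {φ : RSpace n → ℝ}
    (hφ : IsTestFunction Ω φ) :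
    ∫ x in Ω, w none x * Laplacian.laplacian φ x =
      -∑ i, ∫ x in Ω, w (some i) x * partialDeriv i φ x := by
  have hint : ∀ i, Integrable (fun x => w none x * partialDeriv i (partialDeriv i φ) x)
      (volume.restrict Ω) := fun i =>
    (Lp.memLp (w none)).integrable_mul ((hφ.partialDeriv i).partialDeriv i).memLp
  simp_rw [laplacian_eq_sum_partialDeriv hφ.1, Finset.mul_sum]
  rw [integral_finsetSum _ fun i _ => hint i, ← Finset.sum_neg_distrib]
  exact Finset.sum_congr rfl fun i _ =>
    hasWeakPartialDeriv_of_mem_H10 hw i _ (hφ.partialDeriv i)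

/-- The domain of the Dirichlet Laplacian is the range of the resolvent, and `u = (1 - Δ)⁻¹ (u - f)`
says that `Δu = f`. -/
theorem isDirichletLaplacian_iff {u f : L2 Ω} :
    IsDirichletLaplacian Ω u f ↔ dirichletResolvent Ω (u - f) = u := by
  constructor
  · rintro ⟨hu, hf⟩
    obtain ⟨w, hw, rfl⟩ := memH10_iff.1 hu
    have key : ∀ v ∈ H10 Ω, ⟪w, v⟫_ℝ = ⟪w none - f, v none⟫_ℝ := by
      intro v hv
      have hcl : IsClosed {v : H1Ambient Ω | ⟪w, v⟫_ℝ = ⟪w none - f, v none⟫_ℝ} :=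
        isClosed_eq (by fun_prop) (by fun_prop)
      refine closure_minimal ?_ hcl hv
      rintro p ⟨φ, hφ, h0, h1⟩
      have h2 := setIntegral_mul_laplacian hw hφ
      rw [hf φ hφ, ← real_inner_eq_setIntegral_mul _ h0] at h2
      simp_rw [← fun i => real_inner_eq_setIntegral_mul (w (some i)) (h1 i)] at h2
      rw [mem_ofPred_eq, H1Ambient.inner_eq, inner_sub_left, h2]
      ring
    have hadj : ContinuousLinearMap.adjoint (H10.incl Ω) (w none - f) = ⟨w, hw⟩ := by
      refine ext_inner_right ℝ fun v => ?_
      rw [ContinuousLinearMap.adjoint_inner_left]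
      exact (key v.1 v.2).symm
    rw [dirichletResolvent, ContinuousLinearMap.comp_apply, hadj]
    rfl
  · intro h
    set w := ContinuousLinearMap.adjoint (H10.incl Ω) (u - f) with hwdef
    have hwu : w.1 none = u := h
    refine ⟨memH10_iff.2 ⟨w.1, w.2, hwu⟩, fun φ hφ => ?_⟩
    obtain ⟨p, hp, h0, h1⟩ := exists_mem_testGraph hφ
    have hp' : p ∈ H10 Ω := (testGraph Ω).le_topologicalClosure hp
    have h2 : ⟪w, (⟨p, hp'⟩ : H10 Ω)⟫_ℝ = ⟪u - f, p none⟫_ℝ := by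
      rw [hwdef, ContinuousLinearMap.adjoint_inner_left]
      rfl
    rw [Submodule.coe_inner, H1Ambient.inner_eq, hwu, inner_sub_left] at h2
    rw [← hwu, setIntegral_mul_laplacian w.2 hφ, ← real_inner_eq_setIntegral_mul _ h0]
    simp_rw [← fun i => real_inner_eq_setIntegral_mul (w.1 (some i)) (h1 i)]
    linarith

theorem dirichletResolvent_isSymmetric :
    (dirichletResolvent Ω).IsSymmetric := by
  intro u v
  change ⟪dirichletResolvent Ω u, v⟫_ℝ = ⟪u, dirichletResolvent Ω v⟫_ℝ
  simp only [dirichletResolvent, ContinuousLinearMap.comp_apply]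
  rw [← ContinuousLinearMap.adjoint_inner_right, ContinuousLinearMap.adjoint_inner_left]

/-- The resolvent is injective because test functions are dense in `L²(Ω)`. -/
theorem eq_zero_of_dirichletResolvent_eq_zero (hΩ : IsOpen Ω) {f : L2 Ω}
    (hf : dirichletResolvent Ω f = 0) : f = 0 := by
  have h0 : ContinuousLinearMap.adjoint (H10.incl Ω) f = 0 := by
    rw [← inner_self_eq_zero (𝕜 := ℝ), ContinuousLinearMap.adjoint_inner_left]
    change ⟪f, dirichletResolvent Ω f⟫_ℝ = 0
    rw [hf, inner_zero_right]
  have hloc : LocallyIntegrableOn f Ω volume :=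
    locallyIntegrableOn_of_locallyIntegrable_restrict
      ((Lp.memLp f).locallyIntegrable (by norm_num))
  have := hΩ.ae_eq_zero_of_integral_contDiff_smul_eq_zero hloc fun g hg hgc hgs => by
    have hgt : IsTestFunction Ω g := ⟨hg, hgc, hgs⟩
    obtain ⟨p, hp, hp0, -⟩ := exists_mem_testGraph hgt
    have hp' : p ∈ H10 Ω := (testGraph Ω).le_topologicalClosure hp
    have h2 : ⟪f, p none⟫_ℝ = 0 := by
      have : ⟪ContinuousLinearMap.adjoint (H10.incl Ω) f, (⟨p, hp'⟩ : H10 Ω)⟫_ℝ = 0 := by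
        rw [h0, inner_zero_left]
      rwa [ContinuousLinearMap.adjoint_inner_left] at this
    rw [real_inner_eq_setIntegral_mul _ hp0, setIntegral_eq_integral_of_forall_compl_eq_zero
      fun x hx => by rw [hgt.eq_zero_of_notMem hx, mul_zero]] at h2
    simpa [mul_comm] using h2
  refine Lp.ext ?_
  filter_upwards [(ae_restrict_iff' hΩ.measurableSet).2 this, Lp.coeFn_zero ℝ 2 (volume.restrict Ω)]
    with x hx hx'
  rw [hx, hx', Pi.zero_apply]

end Resolvent

/-! ### Compactness of the embedding of `H₀¹(Ω)` into `L²(Ω)` -/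

section Rellich

variable {n : ℕ}

/-- The Cauchy–Schwarz inequality against the constant function `1`. -/
theorem sq_lintegral_le_measure_univ_mul {α : Type*} [MeasurableSpace α] (μ : Measure α)
    {f : α → ℝ≥0∞} (hf : AEMeasurable f μ) :
    (∫⁻ a, f a ∂μ) ^ 2 ≤ μ univ * ∫⁻ a, f a ^ 2 ∂μ := by
  have h := ENNReal.lintegral_mul_le_Lp_mul_Lq μ Real.HolderConjugate.two_two hf
    (aemeasurable_const (b := (1 : ℝ≥0∞)))
  have hsq : ∀ a : ℝ≥0∞, (a ^ (1 / 2 : ℝ)) ^ 2 = a := fun a => by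
    rw [← ENNReal.rpow_natCast, ← ENNReal.rpow_mul]; norm_num
  calc (∫⁻ a, f a ∂μ) ^ 2
      ≤ ((∫⁻ a, f a ^ (2 : ℝ) ∂μ) ^ (1 / 2 : ℝ) *
          (∫⁻ _, (1 : ℝ≥0∞) ^ (2 : ℝ) ∂μ) ^ (1 / 2 : ℝ)) ^ 2 := by
        gcongr
        simpa using h
    _ = μ univ * ∫⁻ a, f a ^ 2 ∂μ := by
        rw [mul_pow, hsq, hsq, mul_comm]
        simp

theorem sum_enorm_sq_partialDeriv (φ : RSpace n → ℝ) (x : RSpace n) :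
    ∑ i, ‖partialDeriv i φ x‖ₑ ^ 2 = ‖fderiv ℝ φ x‖ₑ ^ 2 := by
  have h := (EuclideanSpace.basisFun (Fin n) ℝ).sum_sq_norm_inner_left
    ((InnerProductSpace.toDual ℝ (RSpace n)).symm (fderiv ℝ φ x))
  simp only [InnerProductSpace.toDual_symm_apply, EuclideanSpace.basisFun_apply,
    LinearIsometryEquiv.norm_map] at h
  have h' : ∀ a : ℝ, ‖a‖ₑ ^ 2 = ENNReal.ofReal (‖a‖ ^ 2) := fun a => by
    rw [← ofReal_norm, ENNReal.ofReal_pow (norm_nonneg _)]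
  rw [← ofReal_norm, ← ENNReal.ofReal_pow (norm_nonneg _), ← h,
    ENNReal.ofReal_sum_of_nonneg fun _ _ => by positivity]
  exact Finset.sum_congr rfl fun i _ => h' _

/-- The `L²` modulus of continuity of a test function is controlled by its gradient. -/
theorem lintegral_enorm_translate_sub_sq_le {φ : RSpace n → ℝ} (hφ : ContDiff ℝ ∞ φ)
    (h : RSpace n) :
    ∫⁻ x, ‖φ (x + h) - φ x‖ₑ ^ 2 ≤ ‖h‖ₑ ^ 2 * ∫⁻ x, ‖fderiv ℝ φ x‖ₑ ^ 2 := by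
  have hcont : Continuous (fderiv ℝ φ) := (hφ.fderiv_right (m := ∞) (by simp)).continuous
  have hpt : ∀ x, ‖φ (x + h) - φ x‖ₑ ^ 2 ≤
      ∫⁻ s in Ioc (0 : ℝ) 1, ‖h‖ₑ ^ 2 * ‖fderiv ℝ φ (x + s • h)‖ₑ ^ 2 := by
    intro x
    have hc : Continuous fun s : ℝ => fderiv ℝ φ (x + s • h) h := by fun_prop
    have hd : ∀ s ∈ uIcc (0 : ℝ) 1,
        HasDerivAt (fun s : ℝ => φ (x + s • h)) (fderiv ℝ φ (x + s • h) h) s := by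
      intro s _
      have h1 : HasDerivAt (fun s : ℝ => x + s • h) h s := by
        simpa using ((hasDerivAt_id s).smul_const h).const_add x
      exact ((hφ.differentiable (by simp) _).hasFDerivAt).comp_hasDerivAt s h1
    have hftc := intervalIntegral.integral_eq_sub_of_hasDerivAt hd (hc.intervalIntegrable _ _)
    rw [one_smul, zero_smul, add_zero, intervalIntegral.integral_of_le zero_le_one] at hftc
    rw [← hftc]
    calc _ ≤ (∫⁻ s in Ioc (0 : ℝ) 1, ‖fderiv ℝ φ (x + s • h) h‖ₑ) ^ 2 := by
          gcongr
          exact enorm_integral_le_lintegral_enorm _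
      _ ≤ (volume.restrict (Ioc (0 : ℝ) 1)) univ *
          ∫⁻ s in Ioc (0 : ℝ) 1, ‖fderiv ℝ φ (x + s • h) h‖ₑ ^ 2 :=
          sq_lintegral_le_measure_univ_mul _ hc.enorm.aemeasurable
      _ = ∫⁻ s in Ioc (0 : ℝ) 1, ‖fderiv ℝ φ (x + s • h) h‖ₑ ^ 2 := by simp
      _ ≤ _ := by
          refine lintegral_mono fun s => ?_
          rw [← mul_pow, mul_comm]
          gcongr
          exact ContinuousLinearMap.le_opENorm _ _
  calc _ ≤ ∫⁻ x, ∫⁻ s in Ioc (0 : ℝ) 1, ‖h‖ₑ ^ 2 * ‖fderiv ℝ φ (x + s • h)‖ₑ ^ 2 :=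
        lintegral_mono hpt
    _ = ∫⁻ s in Ioc (0 : ℝ) 1, ∫⁻ x, ‖h‖ₑ ^ 2 * ‖fderiv ℝ φ (x + s • h)‖ₑ ^ 2 := by
        refine lintegral_lintegral_swap (Continuous.aemeasurable ?_)
        have h2 : Continuous fun p : RSpace n × ℝ => ‖fderiv ℝ φ (p.1 + p.2 • h)‖ₑ ^ 2 :=
          (ENNReal.continuous_pow 2).comp (by fun_prop)
        exact (ENNReal.continuous_const_mul (by simp)).comp h2
    _ = ∫⁻ _ in Ioc (0 : ℝ) 1, ‖h‖ₑ ^ 2 * ∫⁻ x, ‖fderiv ℝ φ x‖ₑ ^ 2 := by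
        refine lintegral_congr fun s => ?_
        rw [lintegral_const_mul' _ _ (by simp)]
        congr 1
        exact lintegral_add_right_eq_self (fun x => ‖fderiv ℝ φ x‖ₑ ^ 2) (s • h)
    _ = _ := by simp

/-- The index of the cube of the grid `δ ℤⁿ` containing `x`. -/
noncomputable def cellIndex (δ : ℝ) (x : RSpace n) : Fin n → ℤ := fun i => ⌊x i / δ⌋

/-- The half-open cube of side `δ` with index `k`. -/
def cell (δ : ℝ) (k : Fin n → ℤ) : Set (RSpace n) := cellIndex δ ⁻¹' {k}

theorem volume_setOf_forall_mem (I : Fin n → Set ℝ) (hI : ∀ i, MeasurableSet (I i)) :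
    volume {x : RSpace n | ∀ i, x i ∈ I i} = ∏ i, volume (I i) := by
  rw [← volume_pi_pi, ← (PiLp.volume_preserving_ofLp (Fin n)).measure_preimage
    (MeasurableSet.univ_pi hI).nullMeasurableSet]
  congr 1
  ext x
  simp

theorem measurable_cellIndex (δ : ℝ) : Measurable (cellIndex (n := n) δ) :=
  measurable_pi_lambda _ fun i => Int.measurable_floor.comp (by fun_prop)

theorem measurableSet_cell (δ : ℝ) (k : Fin n → ℤ) : MeasurableSet (cell δ k) :=
  measurable_cellIndex δ (measurableSet_singleton k)

theorem volume_cell {δ : ℝ} (hδ : 0 < δ) (k : Fin n → ℤ) :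
    volume (cell δ k) = ENNReal.ofReal (δ ^ n) := by
  have : cell δ k = {x : RSpace n | ∀ i, x i ∈ Ico (k i * δ) ((k i + 1) * δ)} := by
    ext x
    simp [cell, cellIndex, funext_iff, Int.floor_eq_iff, le_div_iff₀ hδ, div_lt_iff₀ hδ]
  rw [this, volume_setOf_forall_mem _ fun _ => measurableSet_Ico]
  simp [add_mul, ENNReal.ofReal_pow hδ.le]

theorem abs_sub_lt_of_mem_cell {δ : ℝ} (hδ : 0 < δ) {x z : RSpace n}
    (hz : z ∈ cell δ (cellIndex δ x)) (i : Fin n) : |z i - x i| < δ := by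
  have h := Int.abs_sub_lt_one_of_floor_eq_floor (congrFun (mem_singleton_iff.1 hz) i)
  rwa [← sub_div, abs_div, abs_of_pos hδ, div_lt_one hδ] at h

/-- The mean of `f` over the grid cube containing `x`. -/
noncomputable def cellAverage (δ : ℝ) (f : RSpace n → ℝ) (x : RSpace n) : ℝ :=
  (δ ^ n)⁻¹ * ∫ z in cell δ (cellIndex δ x), f z

/-- The deviation from the cell average is bounded by the mean square of the translates
`f (x + h) - f x`: a point of the cell of `x` has the form `x + h` with `|hᵢ| < δ`. The set of `h`
no longer depends on `x`, so the right-hand side can be integrated in `x` by Tonelli. -/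
theorem enorm_sub_cellAverage_sq_le {δ : ℝ} (hδ : 0 < δ) {f : RSpace n → ℝ}
    (hf : Continuous f) (hfc : HasCompactSupport f) (x : RSpace n) :
    ‖f x - cellAverage δ f x‖ₑ ^ 2 ≤ (ENNReal.ofReal (δ ^ n))⁻¹ *
      ∫⁻ h in {h : RSpace n | ∀ i, h i ∈ Ioo (-δ) δ}, ‖f (x + h) - f x‖ₑ ^ 2 := by
  set C := cell δ (cellIndex δ x)
  have hpos : 0 < δ ^ n := pow_pos hδ n
  have hvol : volume C = ENNReal.ofReal (δ ^ n) := volume_cell hδ _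
  have hq0 : ENNReal.ofReal (δ ^ n) ≠ 0 := by simpa using hpos
  have hfin : volume C ≠ ⊤ := by rw [hvol]; exact ENNReal.ofReal_ne_top
  have heq : f x - cellAverage δ f x = (δ ^ n)⁻¹ * ∫ z in C, (f x - f z) := by
    have hconst : IntegrableOn (fun _ => f x) C := integrableOn_const hfin (by simp)
    have hint : IntegrableOn f C := (hf.integrable_of_hasCompactSupport hfc).integrableOn
    rw [integral_sub hconst hint, setIntegral_const,
      Measure.real, hvol, ENNReal.toReal_ofReal hpos.le, smul_eq_mul, mul_sub,
      inv_mul_cancel_left₀ hpos.ne']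
    rfl
  have hinv : ‖(δ ^ n)⁻¹‖ₑ = (ENNReal.ofReal (δ ^ n))⁻¹ := by
    rw [Real.enorm_eq_ofReal (by positivity), ENNReal.ofReal_inv_of_pos hpos]
  rw [heq, enorm_mul, mul_pow, hinv]
  calc _ ≤ (ENNReal.ofReal (δ ^ n))⁻¹ ^ 2 *
        (ENNReal.ofReal (δ ^ n) * ∫⁻ z in C, ‖f z - f x‖ₑ ^ 2) := by
        gcongr
        calc _ ≤ (∫⁻ z in C, ‖f x - f z‖ₑ) ^ 2 := by
              gcongr
              exact enorm_integral_le_lintegral_enorm _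
          _ ≤ _ := by
              have := sq_lintegral_le_measure_univ_mul (volume.restrict C)
                (f := fun z => ‖f x - f z‖ₑ)
                (Continuous.aemeasurable (by fun_prop))
              rw [Measure.restrict_apply_univ, hvol] at this
              simpa only [enorm_sub_rev (f x)] using this
    _ = (ENNReal.ofReal (δ ^ n))⁻¹ * ∫⁻ z in C, ‖f z - f x‖ₑ ^ 2 := by
        rw [sq, mul_assoc, ← mul_assoc _ (ENNReal.ofReal (δ ^ n)),
          ENNReal.inv_mul_cancel hq0 ENNReal.ofReal_ne_top, one_mul]
    _ ≤ _ := by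
        refine mul_le_mul_right ?_ _
        have hD : MeasurableSet {h : RSpace n | ∀ i, h i ∈ Ioo (-δ) δ} := by
          measurability
        rw [← lintegral_indicator (show MeasurableSet C from measurableSet_cell _ _),
          ← lintegral_indicator hD,
          ← lintegral_add_left_eq_self (C.indicator _) x]
        refine lintegral_mono fun h => ?_
        by_cases hh : x + h ∈ C
        · have : h ∈ {h : RSpace n | ∀ i, h i ∈ Ioo (-δ) δ} := fun i => by
            have := abs_sub_lt_of_mem_cell hδ hh i
            simpa [abs_lt] using this
          rw [indicator_of_mem hh, indicator_of_mem this]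
        · rw [indicator_of_notMem hh]
          exact zero_le

/-- Poincaré's inequality on the cubes of a grid, summed over the grid. The factor `2 ^ n` is the
volume ratio of `(-δ, δ)ⁿ` to a cell, and `n * δ ^ 2` bounds `‖h‖²` there. -/
theorem lintegral_enorm_sub_cellAverage_sq_le {δ : ℝ} (hδ : 0 < δ) {φ : RSpace n → ℝ}
    (hφ : ContDiff ℝ ∞ φ) (hφc : HasCompactSupport φ) :
    ∫⁻ x, ‖φ x - cellAverage δ φ x‖ₑ ^ 2 ≤
      ENNReal.ofReal (2 ^ n * (n * δ ^ 2)) * ∫⁻ x, ‖fderiv ℝ φ x‖ₑ ^ 2 := by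
  have hpos : 0 < δ ^ n := pow_pos hδ n
  set D := {h : RSpace n | ∀ i, h i ∈ Ioo (-δ) δ} with hD
  have hvol : volume D = ENNReal.ofReal (δ ^ n) * ENNReal.ofReal (2 ^ n) := by
    rw [hD, volume_setOf_forall_mem _ fun _ => measurableSet_Ioo,
      ← ENNReal.ofReal_mul hpos.le, ← mul_pow]
    simp only [Real.volume_Ioo, Finset.prod_const, Finset.card_univ, Fintype.card_fin]
    rw [ENNReal.ofReal_pow (by positivity)]
    congr 2
    ring
  have hmeas : MeasurableSet D := by rw [hD]; measurability
  have hcont := hφ.continuous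
  set G := ∫⁻ x, ‖fderiv ℝ φ x‖ₑ ^ 2
  calc _ ≤ ∫⁻ x, (ENNReal.ofReal (δ ^ n))⁻¹ * ∫⁻ h in D, ‖φ (x + h) - φ x‖ₑ ^ 2 :=
        lintegral_mono fun x => enorm_sub_cellAverage_sq_le hδ hcont hφc x
    _ = (ENNReal.ofReal (δ ^ n))⁻¹ * ∫⁻ h in D, ∫⁻ x, ‖φ (x + h) - φ x‖ₑ ^ 2 := by
        rw [lintegral_const_mul' _ _ (ENNReal.inv_ne_top.2 (by simpa using hpos)),
          lintegral_lintegral_swap (Continuous.aemeasurable ?_)]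
        exact (ENNReal.continuous_pow 2).comp (by fun_prop)
    _ ≤ (ENNReal.ofReal (δ ^ n))⁻¹ * ∫⁻ _ in D, ENNReal.ofReal (n * δ ^ 2) * G := by
        gcongr _ * ?_
        refine setLIntegral_mono' hmeas fun h hh => ?_
        refine (lintegral_enorm_translate_sub_sq_le hφ h).trans ?_
        gcongr
        rw [← ofReal_norm, ← ENNReal.ofReal_pow (norm_nonneg _)]
        refine ENNReal.ofReal_le_ofReal ?_
        rw [EuclideanSpace.norm_sq_eq]
        refine (Finset.sum_le_card_nsmul _ _ (δ ^ 2) fun i _ => ?_).trans_eq (by simp)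
        exact pow_le_pow_left₀ (norm_nonneg _) (abs_lt.2 (hh i)).le 2
    _ = _ := by
        rw [setLIntegral_const, hvol, ENNReal.ofReal_mul (by positivity : (0 : ℝ) ≤ 2 ^ n)]
        have : (ENNReal.ofReal (δ ^ n))⁻¹ * ENNReal.ofReal (δ ^ n) = 1 :=
          ENNReal.inv_mul_cancel (by simpa using hpos) ENNReal.ofReal_ne_top
        calc _ = ((ENNReal.ofReal (δ ^ n))⁻¹ * ENNReal.ofReal (δ ^ n)) *
              (ENNReal.ofReal (2 ^ n) * ENNReal.ofReal (n * δ ^ 2) * G) := by ring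
          _ = _ := by rw [this, one_mul]

variable {Ω : Set (RSpace n)}

theorem volume_restrict_cell_ne_top {δ : ℝ} (hδ : 0 < δ) (k : Fin n → ℤ) :
    volume.restrict Ω (cell δ k) ≠ ⊤ :=
  ((Measure.restrict_apply_le _ _).trans_lt (by rw [volume_cell hδ]; simp)).ne

/-- Averaging over the cubes with index in `S`, as a finite rank operator on `L²(Ω)`. -/
noncomputable def cellProjection (Ω : Set (RSpace n)) {δ : ℝ} (hδ : 0 < δ)
    (S : Finset (Fin n → ℤ)) : L2 Ω →L[ℝ] L2 Ω :=
  ∑ k ∈ S, (δ ^ n)⁻¹ •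
    (innerSL ℝ (indicatorConstLp 2 (measurableSet_cell δ k)
      (volume_restrict_cell_ne_top (Ω := Ω) hδ k) (1 : ℝ))).smulRight
    (indicatorConstLp 2 (measurableSet_cell δ k) (volume_restrict_cell_ne_top hδ k) (1 : ℝ))

theorem isCompactOperator_cellProjection {δ : ℝ} (hδ : 0 < δ) (S : Finset (Fin n → ℤ)) :
    IsCompactOperator (cellProjection Ω hδ S) := by
  change cellProjection Ω hδ S ∈ compactOperator (RingHom.id ℝ) (L2 Ω) (L2 Ω)
  refine Submodule.sum_mem _ fun k _ => Submodule.smul_mem _ _ ?_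
  exact (isCompactOperator_of_locallyCompactSpace_dom (innerSL ℝ _ : L2 Ω →L[ℝ] ℝ)).clm_comp
    (ContinuousLinearMap.toSpanSingleton ℝ _)

/-- On a test function the operator is averaging over whole cells, as the function vanishes on the
part of a cell outside `Ω`. -/
theorem cellProjection_ae_eq {δ : ℝ} (hδ : 0 < δ) {S : Finset (Fin n → ℤ)}
    (hΩ : MeasurableSet Ω) (hS : ∀ x ∈ Ω, cellIndex δ x ∈ S) {φ : RSpace n → ℝ}
    (hφ : IsTestFunction Ω φ) {u : L2 Ω} (hu : u =ᵐ[volume.restrict Ω] φ) :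
    cellProjection Ω hδ S u =ᵐ[volume.restrict Ω] cellAverage δ φ := by
  have hint : ∀ k, ⟪indicatorConstLp 2 (measurableSet_cell δ k)
      (volume_restrict_cell_ne_top (Ω := Ω) hδ k) (1 : ℝ), u⟫_ℝ = ∫ z in cell δ k, φ z := by
    intro k
    rw [L2.inner_indicatorConstLp_one,
      integral_congr_ae (ae_restrict_of_ae hu), Measure.restrict_restrict (measurableSet_cell δ k)]
    exact setIntegral_eq_of_subset_of_forall_sdiff_eq_zero (measurableSet_cell δ k)
      inter_subset_left (fun x hx => hφ.eq_zero_of_notMem fun h => hx.2 ⟨hx.1, h⟩) |>.symm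
  have hval : cellProjection Ω hδ S u = ∑ k ∈ S, ((δ ^ n)⁻¹ * ∫ z in cell δ k, φ z) •
      indicatorConstLp 2 (measurableSet_cell δ k)
        (volume_restrict_cell_ne_top (Ω := Ω) hδ k) (1 : ℝ) := by
    simp only [cellProjection, sum_apply, smul_apply,
      ContinuousLinearMap.smulRight_apply, innerSL_apply_apply, hint, smul_smul]
  rw [hval]
  have hone : ∀ k ∈ S, ∀ᵐ x ∂volume.restrict Ω, (((δ ^ n)⁻¹ * ∫ z in cell δ k, φ z) •
      indicatorConstLp 2 (measurableSet_cell δ k)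
        (volume_restrict_cell_ne_top (Ω := Ω) hδ k) (1 : ℝ) : L2 Ω) x =
      ((δ ^ n)⁻¹ * ∫ z in cell δ k, φ z) * (cell δ k).indicator (fun _ => (1 : ℝ)) x := by
    intro k _
    filter_upwards [Lp.coeFn_smul ((δ ^ n)⁻¹ * ∫ z in cell δ k, φ z)
      (indicatorConstLp 2 (measurableSet_cell δ k)
        (volume_restrict_cell_ne_top (Ω := Ω) hδ k) (1 : ℝ)),
      indicatorConstLp_coeFn (p := 2) (hs := measurableSet_cell δ k)
        (hμs := volume_restrict_cell_ne_top (Ω := Ω) hδ k) (c := (1 : ℝ))] with x h1 h2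
    rw [h1, Pi.smul_apply, h2, smul_eq_mul]
  filter_upwards [Lp.coeFn_finsetSum S fun k => ((δ ^ n)⁻¹ * ∫ z in cell δ k, φ z) •
      indicatorConstLp 2 (measurableSet_cell δ k)
        (volume_restrict_cell_ne_top (Ω := Ω) hδ k) (1 : ℝ),
    (Finset.eventually_all S).2 hone, ae_restrict_mem hΩ] with x h1 h2 hx
  rw [h1, Finset.sum_apply, Finset.sum_congr rfl h2,
    Finset.sum_eq_single_of_mem _ (hS x hx) fun k _ hk => ?_]
  · rw [indicator_of_mem (show x ∈ cell δ (cellIndex δ x) from rfl), mul_one, cellAverage]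
  · rw [indicator_of_notMem (show x ∉ cell δ k from fun h => hk (mem_singleton_iff.1 h).symm), mul_zero]

theorem enorm_sq_eq_lintegral {u : L2 Ω} {f : RSpace n → ℝ} (hu : u =ᵐ[volume.restrict Ω] f) :
    ‖u‖ₑ ^ 2 = ∫⁻ x in Ω, ‖f x‖ₑ ^ 2 := by
  rw [Lp.enorm_def, eLpNorm_congr_ae hu,
    eLpNorm_eq_lintegral_rpow_enorm_toReal (by norm_num) (by norm_num),
    ← ENNReal.rpow_natCast, ← ENNReal.rpow_mul]
  simp

/-- Averaging over cells of side `δ` approximates the inclusion `H₀¹(Ω) → L²(Ω)` in operator norm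
at rate `δ`; by density the estimate need only be checked on test functions. -/
theorem norm_cellProjection_comp_incl_sub_le {δ : ℝ} (hδ : 0 < δ) {S : Finset (Fin n → ℤ)}
    (hΩ : MeasurableSet Ω) (hS : ∀ x ∈ Ω, cellIndex δ x ∈ S) :
    ‖(cellProjection Ω hδ S).comp (H10.incl Ω) - H10.incl Ω‖ ≤ √(2 ^ n * n) * δ := by
  refine ContinuousLinearMap.opNorm_le_bound _ (by positivity) ?_
  rintro ⟨w, hw⟩
  change ‖cellProjection Ω hδ S (w none) - w none‖ ≤ √(2 ^ n * n) * δ * ‖w‖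
  rw [norm_sub_rev]
  refine closure_minimal (t := {w : H1Ambient Ω |
    ‖w none - cellProjection Ω hδ S (w none)‖ ≤ √(2 ^ n * n) * δ * ‖w‖}) ?_
    (isClosed_le (by fun_prop) (by fun_prop)) hw
  rintro w ⟨φ, hφ, h0, h1⟩
  have hgrad : ∫⁻ x, ‖fderiv ℝ φ x‖ₑ ^ 2 ≤ ENNReal.ofReal (‖w‖ ^ 2) := by
    have hsupp : ∀ i, ∫⁻ x, ‖partialDeriv i φ x‖ₑ ^ 2 = ENNReal.ofReal (‖w (some i)‖ ^ 2) := by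
      intro i
      rw [ENNReal.ofReal_pow (norm_nonneg _), ofReal_norm, enorm_sq_eq_lintegral (h1 i),
        ← lintegral_indicator hΩ, indicator_eq_self.2]
      intro x hx
      by_contra h
      simp [(hφ.partialDeriv i).eq_zero_of_notMem h] at hx
    simp_rw [← sum_enorm_sq_partialDeriv]
    rw [lintegral_finsetSum _ fun i _ => ?_]
    · simp_rw [hsupp]
      rw [← ENNReal.ofReal_sum_of_nonneg fun _ _ => by positivity]
      refine ENNReal.ofReal_le_ofReal ?_
      rw [PiLp.norm_sq_eq_of_L2, Fintype.sum_option]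
      exact le_add_of_nonneg_left (by positivity)
    · exact ((ENNReal.continuous_pow 2).comp
        ((hφ.partialDeriv i).1.continuous.enorm)).measurable
  have hae : (w none - cellProjection Ω hδ S (w none) : L2 Ω) =ᵐ[volume.restrict Ω]
      fun x => φ x - cellAverage δ φ x := by
    filter_upwards [Lp.coeFn_sub (w none) (cellProjection Ω hδ S (w none)), h0,
      cellProjection_ae_eq hδ hΩ hS hφ h0] with x e1 e2 e3
    rw [e1, Pi.sub_apply, e2, e3]
  have hsq : ‖w none - cellProjection Ω hδ S (w none)‖ₑ ^ 2 ≤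
      ENNReal.ofReal ((√(2 ^ n * n) * δ * ‖w‖) ^ 2) := by
    rw [enorm_sq_eq_lintegral hae]
    calc _ ≤ ∫⁻ x, ‖φ x - cellAverage δ φ x‖ₑ ^ 2 := setLIntegral_le_lintegral _ _
      _ ≤ _ := lintegral_enorm_sub_cellAverage_sq_le hδ hφ.1 hφ.2.1
      _ ≤ ENNReal.ofReal (2 ^ n * (n * δ ^ 2)) * ENNReal.ofReal (‖w‖ ^ 2) := by gcongr
      _ = _ := by
        rw [← ENNReal.ofReal_mul (by positivity), mul_pow, mul_pow,
          Real.sq_sqrt (by positivity)]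
        ring_nf
  rw [← ofReal_norm, ← ENNReal.ofReal_pow (norm_nonneg _),
    ENNReal.ofReal_le_ofReal_iff (by positivity)] at hsq
  exact (sq_le_sq₀ (norm_nonneg _) (by positivity)).1 hsq

/-- **Rellich's theorem**: for bounded `Ω` the inclusion `H₀¹(Ω) → L²(Ω)` is compact. -/
theorem isCompactOperator_incl (hΩ : MeasurableSet Ω) (hb : Bornology.IsBounded Ω) :
    IsCompactOperator (H10.incl Ω) := by
  -- The inclusion is the norm limit of the finite rank operators given by cells of side `1/(j+1)`.
  obtain ⟨R, hR⟩ := hb.exists_norm_le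
  have hδ : ∀ j : ℕ, 0 < 1 / ((j : ℝ) + 1) := fun j => by positivity
  have hS : ∀ j : ℕ, ∃ S : Finset (Fin n → ℤ), ∀ x ∈ Ω, cellIndex (1 / ((j : ℝ) + 1)) x ∈ S := by
    intro j
    refine ⟨Fintype.piFinset fun _ => Finset.Icc ⌊-R / (1 / ((j : ℝ) + 1))⌋
      ⌊R / (1 / ((j : ℝ) + 1))⌋, fun x hx => Fintype.mem_piFinset.2 fun i => ?_⟩
    have hxi : |x i| ≤ R := (PiLp.norm_apply_le x i).trans (hR x hx)
    rw [abs_le] at hxi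
    exact Finset.mem_Icc.2 ⟨Int.floor_le_floor (div_le_div_of_nonneg_right hxi.1 (hδ j).le),
      Int.floor_le_floor (div_le_div_of_nonneg_right hxi.2 (hδ j).le)⟩
  choose S hS using hS
  refine isCompactOperator_of_tendsto (l := Filter.atTop)
    (F := fun j : ℕ => (cellProjection Ω (hδ j) (S j)).comp (H10.incl Ω)) ?_
    (Filter.Eventually.of_forall fun j =>
      (isCompactOperator_cellProjection (hδ j) (S j)).comp_clm (H10.incl Ω))
  have hlim : Filter.Tendsto (fun j : ℕ => √(2 ^ n * n) * (1 / ((j : ℝ) + 1))) Filter.atTop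
      (nhds 0) := by
    simpa only [mul_zero] using
      (tendsto_one_div_add_atTop_nhds_zero_nat (𝕜 := ℝ)).const_mul √(2 ^ n * n)
  exact (tendsto_iff_norm_sub_tendsto_zero (E := H10 Ω →L[ℝ] L2 Ω)).2
    (squeeze_zero (fun _ => ContinuousLinearMap.opNorm_nonneg _)
      (fun j => norm_cellProjection_comp_incl_sub_le (hδ j) hΩ (hS j)) hlim)

theorem isCompactOperator_dirichletResolvent (hΩ : MeasurableSet Ω) (hb : Bornology.IsBounded Ω) :
    IsCompactOperator (dirichletResolvent Ω) :=
  (isCompactOperator_incl hΩ hb).comp_clm _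

end Rellich

/-! ### The scalar Volterra equation -/

section Volterra

theorem continuous_comp_max_zero {E : Type*} [TopologicalSpace E] {f : ℝ → E}
    (hf : ContinuousOn f (Ici 0)) : Continuous fun t => f (max 0 t) :=
  hf.comp_continuous (by fun_prop) fun t => le_max_left 0 t

theorem intervalIntegrable_of_continuousOn_Ici {E : Type*} [NormedAddCommGroup E] {f : ℝ → E}
    (hf : ContinuousOn f (Ici 0)) {t : ℝ} (ht : 0 ≤ t) : IntervalIntegrable f volume 0 t :=
  (hf.mono fun _ hs => (uIcc_of_le ht ▸ hs).1).intervalIntegrable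

/-- Only values on `[0, ∞)` enter the convolution, so `M` and `y` may be extended to `(-∞, 0)` by
constants. -/
theorem continuousOn_convolution {E : Type*} [NormedAddCommGroup E] [NormedSpace ℝ E]
    {M : ℝ → ℝ} {y : ℝ → E} (hM : ContinuousOn M (Ici 0)) (hy : ContinuousOn y (Ici 0)) :
    ContinuousOn (fun s => ∫ r in (0 : ℝ)..s, M (s - r) • y r) (Ici 0) := by
  have hM' := continuous_comp_max_zero hM
  have hy' := continuous_comp_max_zero hy
  have hcont : Continuous fun s : ℝ =>
      ∫ r in (0 : ℝ)..s, M (max 0 (s - r)) • y (max 0 r) := by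
    refine intervalIntegral.continuous_parametric_intervalIntegral_of_continuous ?_ continuous_id
    exact (hM'.comp (continuous_fst.sub continuous_snd)).smul (hy'.comp continuous_snd)
  refine hcont.continuousOn.congr fun s hs => ?_
  refine intervalIntegral.integral_congr fun r hr => ?_
  rw [uIcc_of_le (mem_Ici.1 hs)] at hr
  simp only [max_eq_right hr.1, max_eq_right (sub_nonneg.2 hr.2)]

/-- Uniqueness for the integrated Volterra equation. On `[0, T]` the equation bounds `|w|` by a
multiple of `∫₀ᵗ |w|`, which therefore vanishes by Grönwall's inequality. -/
theorem eq_zero_of_volterra {M w : ℝ → ℝ} {μ : ℝ} (hM : ContinuousOn M (Ici 0))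
    (hw : ContinuousOn w (Ici 0))
    (heq : ∀ t, 0 ≤ t → w t = -(μ * ∫ s in (0 : ℝ)..t, w s) -
      ∫ s in (0 : ℝ)..t, ∫ r in (0 : ℝ)..s, M (s - r) * w r) {T : ℝ} (hT : 0 ≤ T) :
    w T = 0 := by
  obtain ⟨B, hB⟩ := isCompact_Icc.exists_bound_of_continuousOn
    (hM.mono (Icc_subset_Ici_self : Icc 0 T ⊆ Ici 0))
  have hB0 : 0 ≤ B := (norm_nonneg _).trans (hB 0 ⟨le_rfl, hT⟩)
  have hw' : Continuous fun t => |w (max 0 t)| := (continuous_comp_max_zero hw).abs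
  set g : ℝ → ℝ := fun t => ∫ s in (0 : ℝ)..t, |w (max 0 s)| with hg
  have hderiv : ∀ t, HasDerivAt g |w (max 0 t)| t := fun t =>
    intervalIntegral.integral_hasDerivAt_right (hw'.intervalIntegrable _ _)
      (hw'.stronglyMeasurableAtFilter _ _) hw'.continuousAt
  have hg_mono : ∀ s t, 0 ≤ s → s ≤ t → g s ≤ g t := fun s t hs hst =>
    intervalIntegral.integral_mono_interval le_rfl hs hst
      (Filter.Eventually.of_forall fun _ => abs_nonneg _) (hw'.intervalIntegrable _ _)
  have hg0 : ∀ t, 0 ≤ t → 0 ≤ g t := fun t ht =>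
    intervalIntegral.integral_nonneg ht fun _ _ => abs_nonneg _
  have hconv : ∀ s, 0 ≤ s → s ≤ T → ‖∫ r in (0 : ℝ)..s, M (s - r) * w r‖ ≤ B * g s := by
    intro s hs hsT
    rw [hg, ← intervalIntegral.integral_const_mul]
    refine intervalIntegral.norm_integral_le_of_norm_le hs
      (Filter.Eventually.of_forall fun r hr => ?_) ((hw'.intervalIntegrable _ _).const_mul B)
    rw [norm_mul, max_eq_right hr.1.le, Real.norm_eq_abs (w r)]
    exact mul_le_mul_of_nonneg_right
      (hB _ ⟨sub_nonneg.2 hr.2, by linarith [hr.1]⟩) (abs_nonneg _)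
  have hbound : ∀ t, 0 ≤ t → t ≤ T → |w t| ≤ (|μ| + B * T) * g t := by
    intro t ht htT
    have h1 : ‖∫ s in (0 : ℝ)..t, w s‖ ≤ g t :=
      intervalIntegral.norm_integral_le_of_norm_le ht
        (Filter.Eventually.of_forall fun r hr => by
          rw [max_eq_right hr.1.le, Real.norm_eq_abs]) (hw'.intervalIntegrable _ _)
    have h2 : ‖∫ s in (0 : ℝ)..t, ∫ r in (0 : ℝ)..s, M (s - r) * w r‖ ≤ B * g t * |t - 0| :=
      intervalIntegral.norm_integral_le_of_norm_le_const fun s hs => by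
        rw [uIoc_of_le ht] at hs
        exact (hconv s hs.1.le (hs.2.trans htT)).trans
          (mul_le_mul_of_nonneg_left (hg_mono s t hs.1.le hs.2) hB0)
    rw [sub_zero, abs_of_nonneg ht] at h2
    have h3 : B * g t * t ≤ B * g t * T :=
      mul_le_mul_of_nonneg_left htT (mul_nonneg hB0 (hg0 t ht))
    have h4 : |μ| * ‖∫ s in (0 : ℝ)..t, w s‖ ≤ |μ| * g t :=
      mul_le_mul_of_nonneg_left h1 (abs_nonneg _)
    rw [heq t ht]
    calc _ ≤ |μ| * ‖∫ s in (0 : ℝ)..t, w s‖ +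
          ‖∫ s in (0 : ℝ)..t, ∫ r in (0 : ℝ)..s, M (s - r) * w r‖ := by
          refine (abs_sub _ _).trans_eq ?_
          rw [abs_neg, abs_mul, Real.norm_eq_abs, Real.norm_eq_abs]
      _ ≤ _ := by linarith
  have hgT : ‖g T‖ ≤ gronwallBound 0 (|μ| + B * T) 0 (T - 0) := by
    refine norm_le_gronwallBound_of_norm_deriv_right_le (f' := fun t => |w (max 0 t)|)
      (fun t _ => (hderiv t).continuousAt.continuousWithinAt)
      (fun t _ => (hderiv t).hasDerivWithinAt) (by simp [hg]) (fun t ht => ?_) T ⟨hT, le_rfl⟩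
    rw [add_zero, Real.norm_of_nonneg (abs_nonneg _), Real.norm_of_nonneg (hg0 t ht.1),
      max_eq_right ht.1]
    exact hbound t ht.1 ht.2.le
  rw [gronwallBound_ε0_δ0] at hgT
  have hgT0 : g T = 0 := norm_le_zero_iff.1 hgT
  have := hbound T hT le_rfl
  rw [hgT0, mul_zero] at this
  exact abs_nonpos_iff.1 this

/-- The integrated form of the equation of a mode. -/
theorem IsModeSolution.sub_one_eq {M x : ℝ → ℝ} {μ : ℝ} (hx : IsModeSolution M μ x)
    (hM : ContinuousOn M (Ici 0)) {t : ℝ} (ht : 0 ≤ t) :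
    x t - 1 = -(μ * ∫ s in (0 : ℝ)..t, x s) -
      ∫ s in (0 : ℝ)..t, ∫ r in (0 : ℝ)..s, M (s - r) * x r := by
  have hconv := continuousOn_convolution hM hx.continuousOn
  simp only [smul_eq_mul] at hconv
  have i1 := intervalIntegrable_of_continuousOn_Ici hx.continuousOn ht
  have i2 := intervalIntegrable_of_continuousOn_Ici hconv ht
  have i3 : IntervalIntegrable (fun s => -(μ * x s)) volume 0 t := (i1.const_mul μ).neg
  rw [← hx.initial, ← intervalIntegral.integral_eq_sub_of_hasDerivAt_of_le ht
    (hx.continuousOn.mono Icc_subset_Ici_self) (fun s hs => hx.equation s hs.1)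
    (i3.sub i2), intervalIntegral.integral_sub i3 i2,
    intervalIntegral.integral_neg, intervalIntegral.integral_const_mul]

/-- A solution of the integrated scalar equation is its initial value times the mode. -/
theorem IsModeSolution.eq_mul {M x z : ℝ → ℝ} {μ : ℝ} (hx : IsModeSolution M μ x)
    (hM : ContinuousOn M (Ici 0)) (hz : ContinuousOn z (Ici 0))
    (heq : ∀ t, 0 ≤ t → z t - z 0 = -(μ * ∫ s in (0 : ℝ)..t, z s) -
      ∫ s in (0 : ℝ)..t, ∫ r in (0 : ℝ)..s, M (s - r) * z r) {t : ℝ} (ht : 0 ≤ t) :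
    z t = z 0 * x t := by
  have hprod : ∀ {f : ℝ → ℝ}, ContinuousOn f (Ici 0) → ∀ s, 0 ≤ s →
      IntervalIntegrable (fun r => M (s - r) * f r) volume 0 s := fun hf s hs =>
    ContinuousOn.intervalIntegrable <| by
      rw [uIcc_of_le hs]
      exact (hM.comp (by fun_prop) fun r hr => sub_nonneg.2 hr.2).mul
        (hf.mono Icc_subset_Ici_self)
  have hcz := continuousOn_convolution hM hz
  have hcx := continuousOn_convolution hM hx.continuousOn
  simp only [smul_eq_mul] at hcz hcx
  refine sub_eq_zero.1 (eq_zero_of_volterra (w := fun t => z t - z 0 * x t) (μ := μ) hM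
    (hz.sub (continuousOn_const.mul hx.continuousOn)) (fun t ht => ?_) ht)
  have hinner : ∫ s in (0 : ℝ)..t, ∫ r in (0 : ℝ)..s, M (s - r) * (z r - z 0 * x r) =
      (∫ s in (0 : ℝ)..t, ∫ r in (0 : ℝ)..s, M (s - r) * z r) -
        z 0 * ∫ s in (0 : ℝ)..t, ∫ r in (0 : ℝ)..s, M (s - r) * x r := by
    rw [← intervalIntegral.integral_const_mul, ← intervalIntegral.integral_sub
      (intervalIntegrable_of_continuousOn_Ici hcz ht)
      ((intervalIntegrable_of_continuousOn_Ici hcx ht).const_mul _)]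
    refine intervalIntegral.integral_congr fun s hs => ?_
    rw [uIcc_of_le ht] at hs
    rw [← intervalIntegral.integral_const_mul, ← intervalIntegral.integral_sub
      (hprod hz s hs.1) ((hprod hx.continuousOn s hs.1).const_mul _)]
    exact intervalIntegral.integral_congr fun r _ => by ring
  rw [hinner, intervalIntegral.integral_sub (intervalIntegrable_of_continuousOn_Ici hz ht)
    ((intervalIntegrable_of_continuousOn_Ici hx.continuousOn ht).const_mul _),
    intervalIntegral.integral_const_mul]
  linear_combination heq t ht - z 0 * hx.sub_one_eq hM ht

end Volterra

/-! ### Expansion of the solution along eigenfunctions -/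

section Modes

variable {n : ℕ} {Ω : Set (RSpace n)} {M x : ℝ → ℝ} {μ : ℝ} {e : L2 Ω}

/-- The solution issued from an eigenfunction stays on its line. -/
theorem IsModeSolution.isSolution_smul (hx : IsModeSolution M μ x) (hM : ContinuousOn M (Ici 0))
    (he : IsDirichletLaplacian Ω e (-(μ • e))) : IsSolution Ω M e fun t => x t • e where
  continuousOn := hx.continuousOn.smul continuousOn_const
  initial := by rw [hx.initial, one_smul]
  equation t ht := by
    have h2 : x t • e - e + ∫ s in (0 : ℝ)..t, ∫ r in (0 : ℝ)..s, M (s - r) • x r • e =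
        (∫ s in (0 : ℝ)..t, x s) • -(μ • e) := by
      have := hx.sub_one_eq hM ht
      simp_rw [smul_smul, intervalIntegral.integral_smul_const]
      rw [sub_eq_iff_eq_add.1 this]
      module
    rw [isDirichletLaplacian_iff] at he ⊢
    rw [h2, intervalIntegral.integral_smul_const, ← smul_sub, map_smul, he]

/-- The Dirichlet Laplacian acts on the coordinate along an eigenvector of the resolvent as
multiplication by a scalar. -/
theorem IsDirichletLaplacian.inner_eigenvector {u f : L2 Ω} (h : IsDirichletLaplacian Ω u f)
    {ν : ℝ} (hν : ν ≠ 0) (he : dirichletResolvent Ω e = ν • e) :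
    ⟪e, f⟫_ℝ = -((ν⁻¹ - 1) * ⟪e, u⟫_ℝ) := by
  have h1 : ⟪dirichletResolvent Ω e, u - f⟫_ℝ = ⟪e, dirichletResolvent Ω (u - f)⟫_ℝ :=
    dirichletResolvent_isSymmetric e (u - f)
  rw [isDirichletLaplacian_iff.1 h, he, real_inner_smul_left, inner_sub_right] at h1
  field_simp
  linear_combination -h1

/-- The coordinate of a solution along an eigenfunction is the initial coordinate times the
mode. -/
theorem IsSolution.inner_eigenvector_eq {y₀ : L2 Ω} {y : ℝ → L2 Ω} (hy : IsSolution Ω M y₀ y)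
    (hM : ContinuousOn M (Ici 0)) {ν : ℝ} (hν : ν ≠ 0) (he : dirichletResolvent Ω e = ν • e)
    (hx : IsModeSolution M (ν⁻¹ - 1) x) {t : ℝ} (ht : 0 ≤ t) :
    ⟪e, y t⟫_ℝ = ⟪e, y₀⟫_ℝ * x t := by
  have hL : ∀ {f : ℝ → L2 Ω} {s : ℝ}, IntervalIntegrable f volume 0 s →
      ⟪e, ∫ r in (0 : ℝ)..s, f r⟫_ℝ = ∫ r in (0 : ℝ)..s, ⟪e, f r⟫_ℝ := fun hf =>
    ((innerSL ℝ e).intervalIntegral_comp_comm hf).symm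
  have hcz : ContinuousOn (fun t => ⟪e, y t⟫_ℝ) (Ici 0) :=
    continuousOn_const.inner hy.continuousOn
  have := hx.eq_mul hM hcz (fun t ht => ?_) ht
  · simpa only [hy.initial] using this
  have h := (hy.equation t ht).inner_eigenvector hν he
  rw [inner_add_right, inner_sub_right, hL (intervalIntegrable_of_continuousOn_Ici
      (continuousOn_convolution hM hy.continuousOn) ht),
    hL (intervalIntegrable_of_continuousOn_Ici hy.continuousOn ht)] at h
  have hinner : ∫ s in (0 : ℝ)..t, ⟪e, ∫ r in (0 : ℝ)..s, M (s - r) • y r⟫_ℝ =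
      ∫ s in (0 : ℝ)..t, ∫ r in (0 : ℝ)..s, M (s - r) * ⟪e, y r⟫_ℝ := by
    refine intervalIntegral.integral_congr fun s hs => ?_
    rw [uIcc_of_le ht] at hs
    have hi : IntervalIntegrable (fun r => M (s - r) • y r) volume 0 s :=
      ContinuousOn.intervalIntegrable <| by
        rw [uIcc_of_le hs.1]
        exact (hM.comp (by fun_prop) fun r hr => sub_nonneg.2 hr.2).smul
          (hy.continuousOn.mono Icc_subset_Ici_self)
    simp only [hL hi, real_inner_smul_right]
  rw [hinner] at h
  rw [hy.initial]
  linear_combination h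

/-- The eigenfunctions of the Dirichlet Laplacian span a dense subspace of `L²(Ω)`. -/
theorem eq_zero_of_forall_inner_eigenvector (hΩ : IsOpen Ω) (hb : Bornology.IsBounded Ω)
    {u : L2 Ω} (hu : ∀ (e : L2 Ω) (ν : ℝ), e ≠ 0 → ν ≠ 0 → dirichletResolvent Ω e = ν • e →
      ⟪e, u⟫_ℝ = 0) : u = 0 := by
  have hbot := ContinuousLinearMap.orthogonalComplement_iSup_eigenspaces_eq_bot
    (isCompactOperator_dirichletResolvent hΩ.measurableSet hb) dirichletResolvent_isSymmetric
  rw [← Submodule.mem_bot ℝ, ← hbot, ← Submodule.iInf_orthogonal, Submodule.mem_iInf]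
  intro ν
  rw [Submodule.mem_orthogonal]
  intro e he
  have he' : dirichletResolvent Ω e = ν • e := Module.End.mem_eigenspace_iff.1 he
  rcases eq_or_ne e 0 with rfl | he0
  · exact inner_zero_left _
  refine hu e ν he0 ?_ he'
  rintro rfl
  exact he0 (eq_zero_of_dirichletResolvent_eq_zero hΩ (by rw [he', zero_smul]))

theorem isDirichletLaplacian_of_eigenvector {ν : ℝ} (hν : ν ≠ 0)
    (he : dirichletResolvent Ω e = ν • e) : IsDirichletLaplacian Ω e (-((ν⁻¹ - 1) • e)) := by
  have h1 : e - -((ν⁻¹ - 1) • e) = ν⁻¹ • e := by module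
  rw [isDirichletLaplacian_iff, h1, map_smul, he, smul_smul, inv_mul_cancel₀ hν, one_smul]

end Modes

end HeatMemory

theorem mainTheorem6 {n : ℕ} (hn : 1 ≤ n) (Ω : Set (HeatMemory.RSpace n))
    (hΩ : HeatMemory.IsBoundedC2Domain Ω)
    (M : ℝ → ℝ) (hM : ContDiffOn ℝ 2 M (Set.Ici 0))
    (lam : ℕ+ → ℝ) (hlam : Set.range lam = {μ | HeatMemory.IsDirichletEigenvalue Ω μ})
    (x : ℕ+ → ℝ → ℝ) (hx : ∀ k, HeatMemory.IsModeSolution M (lam k) (x k))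
    (m : ℕ) (hm : 1 ≤ m) (t : Fin m → ℝ) (ht : ∀ j, 0 < t j) :
    HeatMemory.HasBackwardUniquenessAt Ω M t ↔
      ∀ k : ℕ+, ∃ j : Fin m, t j ∉ HeatMemory.nodalSet (x k) := by
  have hMc := hM.continuousOn
  constructor
  · intro hbu k
    by_contra! hall
    obtain ⟨e, he0, he⟩ : HeatMemory.IsDirichletEigenvalue Ω (lam k) :=
      hlam.subset (Set.mem_range_self k)
    exact he0 (hbu e _ ((hx k).isSolution_smul hMc he) fun j => by rw [(hall j).2, zero_smul])
  · intro hmodes y₀ y hy hzero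
    -- `ν` is an eigenvalue of `(1 - A)⁻¹`, so `ν⁻¹ - 1` is an eigenvalue of `-A`.
    refine HeatMemory.eq_zero_of_forall_inner_eigenvector hΩ.isOpen hΩ.isBounded
      fun e ν he0 hν he => ?_
    have hmem : ν⁻¹ - 1 ∈ Set.range lam :=
      hlam ▸ ⟨e, he0, HeatMemory.isDirichletLaplacian_of_eigenvector hν he⟩
    obtain ⟨k, hk⟩ := hmem
    obtain ⟨j, hj⟩ := hmodes k
    have h := hy.inner_eigenvector_eq hMc hν he (hk ▸ hx k) (ht j).le
    rw [hzero j, inner_zero_right, eq_comm, mul_eq_zero] at h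
    exact h.resolve_right fun h0 => hj ⟨ht j, h0⟩
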